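/- A \emph{singular hybrid automaton with discrete updates} over the variables $x_1,\dots,x_d$ consists of a finite set $M$ of modes with a set $M_0\subseteq M$ of initial modes; for every mode $m$ an invariant $I(m)\subseteq\mathbb R^d$, given as a finite conjunction of linear constraints $a_1x_1+\dots+a_dx_d\bowtie k$ with $a_i,k\in\mathbb Z$ and ${\bowtie}\in\{<,\le,=,\ge,>\}$ (a polyhedral constraint), and a rate vector $F(m)\in\mathbb Q^d$; and finitely many transitions, each with a source mode $m$, a target mode $m'$, a polyhedral guard $G$, a set $R$ of variables that are reset to $0$, and an additive update $u\in\mathbb Q^d$. A configuration is a pair $(m,\nu)$ with $\nu\in I(m)$. From a configuration $(m,\nu)$ a step lets a time $t\ge 0$ pass, with $\nu+\tau F(m)\in I(m)$ for all $\tau\in[0,t]$ and $\nu+tF(m)\in G$ for some transition with source $m$, and leads to $(m',\nu')$, where $\nu'=(\nu+tF(m))[R:=0]+u$ must lie in $I(m')$. A finite run is a finite, possibly empty, sequence of steps that starts in a configuration whose mode is initial. The automaton is \emph{weak} if there is a rank function $\varrho:M\to\mathbb N$ such that no transition decreases the rank, and for every rank $i$: all modes of rank $i$ have the same invariant $S_i$,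 a bounded polytope (a bounded set defined by a polyhedral constraint); the modes of rank $i$ are strongly connected by transitions; and every transition between two modes of rank $i$ has the trivial guard $G=\mathbb R^d$ and $R=\emptyset$ (but may carry an arbitrary additive update). \textbf{Theorem.} The following reachability problem is undecidable: given a weak singular hybrid automaton with discrete updates over three variables, a starting valuation $\nu_0\in\mathbb Q^3$ and a target polytope $\mathcal T\subseteq\mathbb R^3$ (a bounded polyhedral constraint), decide whether some finite run leads from $\nu_0$ to a valuation in $\mathcal T$. It remains undecidable when all the invariants are required to be closed. -/

import Mathlib

/-- A rational number written as a numerator and a positive denominator. -/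
abbrev Fraction := ℤ × ℕ+

/-- The real number denoted by a fraction. -/
noncomputable def Fraction.val (q : Fraction) : ℝ := (q.1 : ℝ) / ((q.2 : ℕ) : ℝ)

/-- The comparison symbols of linear constraints. -/
inductive Cmp where
  | lt | le | eq | ge | gt

/-- The relation on the reals denoted by a comparison symbol. -/
def Cmp.Holds : Cmp → ℝ → ℝ → Prop
  | .lt, a, b => a < b
  | .le, a, b => a ≤ b
  | .eq, a, b => a = b
  | .ge, a, b => a ≥ b
  | .gt, a, b => a > b

/-- A linear constraint `a₁ x₁ + ⋯ + a_d x_d ⋈ k` with integer coefficients, over `d` variables. -/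
structure LinConstraint (d : ℕ) where
  coeff : Fin d → ℤ
  cmp : Cmp
  bound : ℤ

/-- The valuation `v` satisfies the linear constraint. -/
def LinConstraint.Sat {d : ℕ} (c : LinConstraint d) (v : Fin d → ℝ) : Prop :=
  c.cmp.Holds (∑ i, (c.coeff i : ℝ) * v i) (c.bound : ℝ)

/-- A polyhedral constraint: a finite conjunction of linear constraints.  The empty conjunction
is the constraint that always holds. -/
abbrev Polyhedral (d : ℕ) := List (LinConstraint d)

/-- The set of valuations that satisfy a polyhedral constraint. -/
def Polyhedral.sem {d : ℕ} (G : Polyhedral d) : Set (Fin d → ℝ) :=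
  {v | ∀ c ∈ G, c.Sat v}

/-- The data of a control mode: its invariant and its vector of constant rates. -/
structure ModeData (d : ℕ) where
  inv : Polyhedral d
  flow : Fin d → Fraction

/-- A transition: source mode, guard, set of variables that are reset to `0`, additive discrete
update, target mode. -/
structure Transition (d : ℕ) where
  src : ℕ
  guard : Polyhedral d
  reset : Fin d → Bool
  update : Fin d → Fraction
  tgt : ℕ

/-- A singular hybrid automaton over `d` variables with additive discrete updates on its
transitions.  The modes are the positions in the list `modes`.  The actions are the positions in
the list `trans`, so that each action determines one transition. -/
structure SHA (d : ℕ) where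
  modes : List (ModeData d)
  initial : List ℕ
  trans : List (Transition d)

/-- A configuration: a mode and a valuation of the variables. -/
abbrev Config (d : ℕ) := ℕ × (Fin d → ℝ)

/-- The valuation that is reached from `v` after `t` time units in a mode. -/
noncomputable def ModeData.flowFor {d : ℕ} (μ : ModeData d) (v : Fin d → ℝ) (t : ℝ) :
    Fin d → ℝ :=
  fun i => v i + t * (μ.flow i).val

/-- The effect of a transition on a valuation: the variables in the reset set are set to `0`, and
then every variable `x` is replaced by `x + c`, where `c` is its entry in the update. -/
noncomputable def Transition.apply {d : ℕ} (δ : Transition d) (v : Fin d → ℝ) : Fin d → ℝ :=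
  fun i => (if δ.reset i then 0 else v i) + (δ.update i).val

namespace SHA

variable {d : ℕ}

/-- All modes mentioned by the initial set and by the transitions are modes of the automaton. -/
def WellFormed (H : SHA d) : Prop :=
  (∀ m ∈ H.initial, m < H.modes.length) ∧
    ∀ δ ∈ H.trans, δ.src < H.modes.length ∧ δ.tgt < H.modes.length

/-- Valid configurations: the mode exists and the valuation satisfies its invariant. -/
def IsConfig (H : SHA d) (c : Config d) : Prop :=
  ∃ μ, H.modes[c.1]? = some μ ∧ c.2 ∈ Polyhedral.sem μ.inv

/-- The step from configuration `c` to configuration `c'` by the timed action `(t, a)`. -/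
def Step (H : SHA d) (c : Config d) (t : ℝ) (a : ℕ) (c' : Config d) : Prop :=
  0 ≤ t ∧ H.IsConfig c ∧ H.IsConfig c' ∧
    ∃ μ δ, H.modes[c.1]? = some μ ∧ H.trans[a]? = some δ ∧ δ.src = c.1 ∧ δ.tgt = c'.1 ∧
      (∀ τ ∈ Set.Icc 0 t, μ.flowFor c.2 τ ∈ Polyhedral.sem μ.inv) ∧
      μ.flowFor c.2 t ∈ Polyhedral.sem δ.guard ∧
      c'.2 = δ.apply (μ.flowFor c.2 t)

/-- `H.Run c r c'`: the finite list `r` of timed actions labels a finite run of `H` from the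
configuration `c`, in an initial mode, to the configuration `c'`. -/
inductive Run (H : SHA d) (c : Config d) : List (ℝ × ℕ) → Config d → Prop where
  | start : c.1 ∈ H.initial → H.IsConfig c → Run H c [] c
  | step {r : List (ℝ × ℕ)} {c₁ c₂ : Config d} {t : ℝ} {a : ℕ} :
      Run H c r c₁ → H.Step c₁ t a c₂ → Run H c (r ++ [(t, a)]) c₂

/-- Some transition leads from the mode `m` to the mode `m'`. -/
def Edge (H : SHA d) (m m' : ℕ) : Prop :=
  ∃ δ ∈ H.trans, δ.src = m ∧ δ.tgt = m'

/-- Weak singular hybrid automata with discrete updates.  There is a rank function on the modes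
which no transition decreases, and for every rank `i`: the modes of rank `i` have a common
invariant, a bounded polytope; they are strongly connected; and the transitions among them have
the trivial guard and reset nothing (but may carry an additive update). -/
def IsWeak (H : SHA d) : Prop :=
  H.WellFormed ∧ ∃ ρ : ℕ → ℕ,
    (∀ δ ∈ H.trans, ρ δ.src ≤ ρ δ.tgt) ∧
    ∀ i : ℕ,
      (∃ S : Polyhedral d, Bornology.IsBounded S.sem ∧
        ∀ m μ, H.modes[m]? = some μ → ρ m = i → Polyhedral.sem μ.inv = S.sem) ∧
      (∀ m < H.modes.length, ∀ m' < H.modes.length, ρ m = i → ρ m' = i →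
        Relation.ReflTransGen H.Edge m m') ∧
      (∀ δ ∈ H.trans, ρ δ.src = i → ρ δ.tgt = i →
        Polyhedral.sem δ.guard = Set.univ ∧ ∀ x, δ.reset x = false)

/-- All invariants of the automaton are closed sets. -/
def HasClosedInvariants (H : SHA d) : Prop :=
  ∀ μ ∈ H.modes, IsClosed (Polyhedral.sem μ.inv)

end SHA

/-- An instance of the reachability problem: an automaton, a rational starting valuation and a
target constraint. -/
structure ReachInstance (d : ℕ) where
  aut : SHA d
  start : Fin d → Fraction
  target : Polyhedral d

/-- Some finite run leads from the starting valuation to a valuation in the target. -/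
def ReachInstance.Reachable {d : ℕ} (P : ReachInstance d) : Prop :=
  ∃ (m m' : ℕ) (v' : Fin d → ℝ) (r : List (ℝ × ℕ)),
    P.aut.Run (m, fun i => (P.start i).val) r (m', v') ∧ v' ∈ P.target.sem

section Coding

/-- Comparison symbols as numbers. -/
def Cmp.equivFin : Cmp ≃ Fin 5 where
  toFun
    | .lt => 0
    | .le => 1
    | .eq => 2
    | .ge => 3
    | .gt => 4
  invFun n := match n with
    | 0 => .lt
    | 1 => .le
    | 2 => .eq
    | 3 => .ge
    | 4 => .gt
  left_inv c := by cases c <;> rfl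
  right_inv n := by fin_cases n <;> rfl

/-- Linear constraints as tuples. -/
def LinConstraint.equivProd (d : ℕ) : LinConstraint d ≃ (Fin d → ℤ) × Cmp × ℤ where
  toFun c := (c.coeff, c.cmp, c.bound)
  invFun p := ⟨p.1, p.2.1, p.2.2⟩
  left_inv _ := rfl
  right_inv _ := rfl

/-- Modes as tuples. -/
def ModeData.equivProd (d : ℕ) : ModeData d ≃ Polyhedral d × (Fin d → Fraction) where
  toFun μ := (μ.inv, μ.flow)
  invFun p := ⟨p.1, p.2⟩
  left_inv _ := rfl
  right_inv _ := rfl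

/-- Transitions as tuples. -/
def Transition.equivProd (d : ℕ) :
    Transition d ≃ ℕ × Polyhedral d × (Fin d → Bool) × (Fin d → Fraction) × ℕ where
  toFun δ := (δ.src, δ.guard, δ.reset, δ.update, δ.tgt)
  invFun p := ⟨p.1, p.2.1, p.2.2.1, p.2.2.2.1, p.2.2.2.2⟩
  left_inv _ := rfl
  right_inv _ := rfl

/-- Automata as tuples. -/
def SHA.equivProd (d : ℕ) : SHA d ≃ List (ModeData d) × List ℕ × List (Transition d) where
  toFun H := (H.modes, H.initial, H.trans)
  invFun p := ⟨p.1, p.2.1, p.2.2⟩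
  left_inv _ := rfl
  right_inv _ := rfl

/-- Instances as tuples. -/
def ReachInstance.equivProd (d : ℕ) :
    ReachInstance d ≃ SHA d × (Fin d → Fraction) × Polyhedral d where
  toFun P := (P.aut, P.start, P.target)
  invFun p := ⟨p.1, p.2.1, p.2.2⟩
  left_inv _ := rfl
  right_inv _ := rfl

instance : Primcodable Cmp := Primcodable.ofEquiv _ Cmp.equivFin

instance (d : ℕ) : Primcodable (LinConstraint d) :=
  Primcodable.ofEquiv _ (LinConstraint.equivProd d)

instance (d : ℕ) : Primcodable (ModeData d) :=
  Primcodable.ofEquiv _ (ModeData.equivProd d)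

instance (d : ℕ) : Primcodable (Transition d) :=
  Primcodable.ofEquiv _ (Transition.equivProd d)

instance (d : ℕ) : Primcodable (SHA d) :=
  Primcodable.ofEquiv _ (SHA.equivProd d)

instance (d : ℕ) : Primcodable (ReachInstance d) :=
  Primcodable.ofEquiv _ (ReachInstance.equivProd d)

end Coding

/-! The halting problem reduces to reachability. A universal partial recursive function is computed
by a finite Turing machine, with inputs of the shape `a, b, c, …, c`. The automaton keeps the state
and the scanned symbol in its mode. The half-tapes left and right of the head are stored as base-`B`
expansions `x, y ∈ [0, 1)`, and `z` is a scratch variable. A move that leaves `a` behind and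
uncovers `b` must perform `x ↦ (a + x) / B` and `y ↦ B y - b` (with `x`, `y` exchanged for a move to
the left).

Inside one rank there are no guards or resets, so every test is made by the common invariant, the
closed unit cube. If a coordinate lies in `[0, 1]` both before and after an update by `+1`, it was
`0`. Hence such an update forces the flow to stop exactly when that coordinate is empty. Moving `x`
into `z` at equal speed and back with speeds `1 : B` divides it by `B`; speeds `B : 1` multiply `y`.
These forced stops make up the cycle of eight modes (`cycle_unique`, `cycle_exists`).

The symbol `b` is guessed. The cube admits the result `B y - b` only if it lies in `[0, 1]`, and
since all digits are even this happens only for the first symbol of the half-tape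
(`eq_head_of_mem`).

Strong connectivity comes for free from transitions that add `2` to every variable and so can never
be taken inside the cube. When the machine halts, an update `z + 2` leads to the only mode of rank
`1`, whose box is the target. The automaton is fixed and only the starting valuation depends on the
input, so the reduction is computable. -/

open Turing

/-! ### Finite Turing machines for partial recursive functions -/

/-- A partial recursive function of one variable, precomposed with the discrete logarithm. -/
theorem Partrec.exists_comp_two_pow {f : ℕ →. ℕ} (hf : Partrec f) :
    ∃ g : ℕ →. ℕ, Partrec g ∧ ∀ k, g (2 ^ k) = f k := by
  have hpow : Primrec fun k : ℕ => 2 ^ k :=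
    (Primrec.nat_rec₁ 1 (Primrec.nat_mul.comp (Primrec.const 2) Primrec.snd).to₂).of_eq fun k => by
      induction k with
      | zero => rfl
      | succ k ih => rw [pow_succ']; exact congrArg (2 * ·) ih
  have htest : Primrec₂ fun n k : ℕ => decide (2 ^ k = n) :=
    (Primrec.eq.decide.comp (hpow.comp Primrec.snd) Primrec.fst)
  let p : ℕ → ℕ →. Bool := fun n k => Part.some (decide (2 ^ k = n))
  refine ⟨fun n => (Nat.rfind (p n)).bind f,
    (Partrec.rfind htest.to_comp.partrec₂).bind (hf.comp Computable.snd).to₂, fun k => ?_⟩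
  have : Nat.rfind (p (2 ^ k)) = Part.some k :=
    Part.eq_some_iff.2 <| Nat.mem_rfind.2 ⟨by simp [p], fun {m} hm => by simpa [p] using hm.ne⟩
  change (Nat.rfind (p (2 ^ k))).bind f = f k
  rw [this]
  exact Part.bind_some _ _

/-- Binary numerals start with the least significant bit. Powers of two therefore make the input
essentially unary, with one repeated symbol, and its base-`B` value is easy to compute. -/
theorem Turing.PartrecToTM2.trNat_two_pow (k : ℕ) :
    PartrecToTM2.trNat (2 ^ k) =
      List.replicate k PartrecToTM2.Γ'.bit0 ++ [PartrecToTM2.Γ'.bit1] := by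
  have key : ∃ p : PosNum, ((2 ^ k : ℕ) : Num) = Num.pos p ∧ PartrecToTM2.trPosNum p =
      List.replicate k PartrecToTM2.Γ'.bit0 ++ [PartrecToTM2.Γ'.bit1] := by
    induction k with
    | zero => exact ⟨1, by simp; rfl, rfl⟩
    | succ k ih =>
      obtain ⟨p, hp, hp'⟩ := ih
      refine ⟨p.bit0, ?_, ?_⟩
      · rw [pow_succ, mul_two, Nat.cast_add, hp, ← PosNum.bit0_of_bit0]
        rfl
      · simp [PartrecToTM2.trPosNum, hp', List.replicate_succ]
  obtain ⟨p, hp, hp'⟩ := key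
  rw [PartrecToTM2.trNat, hp, PartrecToTM2.trNum, hp']

/-- A machine never leaves a supporting set of labels, so its labels can be restricted to that set.
Finiteness is needed because labels become modes. -/
theorem Turing.TM0.exists_finite {Γ Λ : Type} [Inhabited Γ] [Inhabited Λ] (M : TM0.Machine Γ Λ)
    (S : Finset Λ) (hS : TM0.Supports M (S : Set Λ)) :
    ∃ (Λ' : Type) (_ : Inhabited Λ') (_ : Finite Λ') (M' : TM0.Machine Γ Λ'), ∀ l : List Γ,
      (TM0.eval M' l).Dom ↔ (TM0.eval M l).Dom := by
  classical
  let i : Inhabited S := ⟨⟨default, hS.1⟩⟩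
  let g₁ : PointedMap Λ S := ⟨fun q => if h : q ∈ S then ⟨q, h⟩ else default, by
    exact dif_pos hS.1⟩
  have hg : ∀ q ∈ (S : Set Λ), ((g₁ q : S) : Λ) = q := fun q hq => by
    change ((if h : q ∈ S then (⟨q, h⟩ : S) else default : S) : Λ) = q
    rw [dif_pos (Finset.mem_coe.1 hq)]
  refine ⟨S, i, inferInstance, M.map ⟨id, rfl⟩ ⟨id, rfl⟩ g₁ Subtype.val, fun l => ?_⟩
  refine StateTransition.tr_eval_dom (TM0.Machine.map_respects M ⟨id, rfl⟩ ⟨id, rfl⟩ g₁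
    Subtype.val hS (fun _ => rfl) hg) (a₁ := TM0.init l) ⟨hS.1, ?_⟩
  rw [TM0.map_init]
  congr 1
  exact List.map_id l

instance : Fintype PartrecToTM2.K' :=
  ⟨{.main, .rev, .aux, .stack}, fun k => by cases k <;> simp⟩

/-- The chain of translations is `ToPartrec.Code`, `TM2`, `TM1`, `TM0`, applied to a function `g`
with `g (2 ^ k) = f k`. All inputs share the shape `a, b, c, …, c`. -/
theorem Turing.TM0.exists_machine_of_partrec {f : ℕ →. ℕ} (hf : Partrec f) :
    ∃ (Γ Λ : Type) (_ : Inhabited Γ) (_ : Finite Γ) (_ : Inhabited Λ) (_ : Finite Λ)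
      (M : TM0.Machine Γ Λ) (a b c : Γ), ∀ k,
      (TM0.eval M (a :: b :: List.replicate k c)).Dom ↔ (f k).Dom := by
  classical
  obtain ⟨g, hg, hgf⟩ := hf.exists_comp_two_pow
  obtain ⟨C, hC⟩ := ToPartrec.Code.exists_code (Nat.Partrec'.part_iff₁.2 hg)
  -- The default label is the initial state, so it must be the entry point of the code `C`.
  let i : Inhabited PartrecToTM2.Λ' := ⟨PartrecToTM2.trNormal C .halt⟩
  let M₁ := TM2to1.tr PartrecToTM2.tr
  have h₁ : TM1.Supports M₁ _ := TM2to1.tr_supports _ (PartrecToTM2.tr_supports C .halt)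
  obtain ⟨Λ', iΛ, fΛ, M', hM'⟩ := TM0.exists_finite (TM1to0.tr M₁) _ (TM1to0.tr_supports M₁ h₁)
  -- A tape cell holds one slice of the four stacks, with a mark for the bottom cell; only the main
  -- stack is filled at the start.
  let sym : Bool → PartrecToTM2.Γ' → TM2to1.Γ' PartrecToTM2.K' fun _ => PartrecToTM2.Γ' :=
    fun t s => (t, Function.update (fun _ => none) .main (some s))
  refine ⟨TM2to1.Γ' PartrecToTM2.K' fun _ => PartrecToTM2.Γ', Λ', inferInstance, inferInstance, iΛ,
    fΛ, M', sym true .cons, sym false .bit1, sym false .bit0, fun k => ?_⟩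
  have e : TM2to1.trInit PartrecToTM2.K'.main (PartrecToTM2.trList [2 ^ k]) =
      sym true .cons :: sym false .bit1 :: List.replicate k (sym false .bit0) := by
    have hrev : (PartrecToTM2.trList [2 ^ k]).reverse =
        .cons :: .bit1 :: List.replicate k .bit0 := by
      simp [PartrecToTM2.trList, PartrecToTM2.trNat_two_pow]
    unfold TM2to1.trInit
    rw [hrev]
    exact congrArg (fun l => sym true .cons :: sym false .bit1 :: l) List.map_replicate
  rw [← e, hM', TM1to0.tr_eval, ← hgf]
  refine (TM2to1.tr_eval_dom _ _ _).trans ?_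
  have h₂ := hC ⟨[2 ^ k], rfl⟩
  have h₃ := PartrecToTM2.tr_eval C [2 ^ k]
  have e₂ : (TM2.init PartrecToTM2.K'.main (PartrecToTM2.trList [2 ^ k])) =
      PartrecToTM2.init C [2 ^ k] := by
    simp only [TM2.init, PartrecToTM2.init]
    congr 1
    funext k; cases k <;> rfl
  change (StateTransition.eval (TM2.step PartrecToTM2.tr)
    (TM2.init PartrecToTM2.K'.main (PartrecToTM2.trList [2 ^ k]))).Dom ↔ _
  rw [e₂]
  refine (iff_of_eq (congrArg Part.Dom h₃)).trans ?_
  change (C.eval _).Dom ↔ _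
  rw [h₂]
  rfl

/-! ### Half-tapes as expansions in base `B` -/

section Numeration

variable {Γ : Type} (B : ℕ) (digit : Γ → ℕ)

/-- The value of a list of symbols, read as the digits after the point in base `B`. -/
noncomputable def listValue (l : List Γ) : ℝ :=
  l.foldr (fun a r => (digit a + r) / B) 0

/-- The blank is the digit `0`, so trailing blanks do not count; this makes the value well defined
on `ListBlank`. -/
theorem listValue_append_replicate [Inhabited Γ] (h : digit default = 0) (l : List Γ) (n : ℕ) :
    listValue B digit (l ++ List.replicate n default) = listValue B digit l := by
  induction l with
  | nil =>
    induction n with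
    | zero => rfl
    | succ n ih =>
      change ((digit default : ℝ) + listValue B digit ([] ++ List.replicate n default)) / B = _
      rw [ih, h]; simp [listValue]
  | cons a l ih => exact congrArg (fun r : ℝ => (digit a + r) / B) ih

theorem listValue_append_singleton (hB : 0 < B) (l : List Γ) (a : Γ) :
    listValue B digit (l ++ [a]) = listValue B digit l + digit a / B ^ (l.length + 1) := by
  have : (B : ℝ) ≠ 0 := by positivity
  induction l with
  | nil => simp [listValue]
  | cons b l ih =>
    change ((digit b : ℝ) + listValue B digit (l ++ [a])) / B =
      ((digit b : ℝ) + listValue B digit l) / B + digit a / B ^ (l.length + 1 + 1)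
    rw [ih, pow_succ _ (l.length + 1)]
    field_simp
    ring

variable [Inhabited Γ]

/-- The value of a half-tape. -/
noncomputable def tapeValue (h : digit default = 0) (l : ListBlank Γ) : ℝ :=
  l.liftOn (listValue B digit) fun a b ⟨n, hn⟩ => by
    rw [hn, listValue_append_replicate B digit h]

theorem tapeValue_mk (h : digit default = 0) (l : List Γ) :
    tapeValue B digit h (ListBlank.mk l) = listValue B digit l := rfl

theorem tapeValue_cons (h : digit default = 0) (a : Γ) (l : ListBlank Γ) :
    tapeValue B digit h (l.cons a) = (digit a + tapeValue B digit h l) / B := by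
  induction l using ListBlank.induction_on with
  | _ l => rfl

theorem tapeValue_nonneg (h : digit default = 0) (l : ListBlank Γ) :
    0 ≤ tapeValue B digit h l := by
  induction l using ListBlank.induction_on with
  | _ l =>
  rw [tapeValue_mk]
  induction l with
  | nil => exact le_rfl
  | cons a l ih => exact div_nonneg (add_nonneg (Nat.cast_nonneg _) ih) (Nat.cast_nonneg _)

theorem tapeValue_lt_one (h : digit default = 0) (hB : ∀ a, digit a + 1 ≤ B) (l : ListBlank Γ) :
    tapeValue B digit h l < 1 := by
  induction l using ListBlank.induction_on with
  | _ l =>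
  rw [tapeValue_mk]
  induction l with
  | nil => exact zero_lt_one
  | cons a l ih =>
    have h₁ : (digit a : ℝ) + 1 ≤ B := by exact_mod_cast hB a
    have h₂ : (0 : ℝ) ≤ digit a := Nat.cast_nonneg _
    change ((digit a : ℝ) + listValue B digit l) / B < 1
    exact (div_lt_one (by linarith)).2 (by linarith)

end Numeration

/-- The symbols of a finite alphabet are numbered by even digits, the blank by `0`. -/
theorem exists_even_digits (Γ : Type) [Inhabited Γ] [Finite Γ] :
    ∃ (B : ℕ) (digit : Γ → ℕ), digit default = 0 ∧ (∀ a, digit a + 1 ≤ B) ∧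
      (∀ a, Even (digit a)) ∧ Function.Injective digit := by
  classical
  obtain ⟨n, ⟨e⟩⟩ := Finite.exists_equiv_fin Γ
  refine ⟨2 * n + 1, fun a => if a = default then 0 else 2 * ((e a : ℕ) + 1), by simp,
    fun a => ?_, fun a => ?_, fun a b hab => ?_⟩
  · have := (e a).isLt
    dsimp only
    split_ifs <;> omega
  · dsimp only
    split_ifs
    · exact Even.zero
    · exact even_two_mul _
  · dsimp only at hab
    split_ifs at hab with h₁ h₂ h₂
    · rw [h₁, h₂]
    · exact e.injective (Fin.ext (by omega))

/-! ### The cycle of eight modes that moves a digit from one number to another -/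

section Cycle

/-- The rates in the `k`-th mode of the cycle. -/
def cycleRate (B : ℕ) : ℕ → ℤ × ℤ × ℤ
  | 0 => (-1, 0, 1)
  | 2 => (1, 0, -B)
  | 4 => (0, -1, 1)
  | 6 => (0, B, -1)
  | _ => (0, 0, 0)

/-- The update on leaving the `k`-th mode of the cycle, multiplied by `B`. -/
def cycleUpdate (B a b : ℕ) : ℕ → ℤ × ℤ × ℤ
  | 0 => (B, 0, 0)
  | 1 => (-B, 0, 0)
  | 2 => (0, 0, B)
  | 3 => (a, -b, -B)
  | 4 => (0, B, 0)
  | 5 => (0, -B, 0)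
  | 6 => (0, 0, B)
  | _ => (0, 0, -B)

/-- The values of the variables on entering the `k`-th mode of the cycle. -/
noncomputable def cycleValue (B a b : ℕ) (x y : ℝ) : ℕ → ℝ × ℝ × ℝ
  | 0 => (x, y, 0)
  | 1 => (1, y, x)
  | 2 => (0, y, x)
  | 3 => (x / B, y, 1)
  | 4 => ((a + x) / B, y - b / B, 0)
  | 5 => ((a + x) / B, 1, y - b / B)
  | 6 => ((a + x) / B, 0, y - b / B)
  | 7 => ((a + x) / B, B * y - b, 1)
  | _ => ((a + x) / B, B * y - b, 0)

/-- The time spent in the `k`-th mode of the cycle. -/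
noncomputable def cycleTime (B b : ℕ) (x y : ℝ) : ℕ → ℝ
  | 0 => x
  | 2 => x / B
  | 4 => y - b / B
  | 6 => y - b / B
  | _ => 0

/-- The unit cube. -/
def InCube (p : ℝ × ℝ × ℝ) : Prop :=
  (0 ≤ p.1 ∧ p.1 ≤ 1) ∧ (0 ≤ p.2.1 ∧ p.2.1 ≤ 1) ∧ 0 ≤ p.2.2 ∧ p.2.2 ≤ 1

/-- Moving for time `t` with integer rates. -/
def drift (r : ℤ × ℤ × ℤ) (t : ℝ) (p : ℝ × ℝ × ℝ) : ℝ × ℝ × ℝ :=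
  (p.1 + t * r.1, p.2.1 + t * r.2.1, p.2.2 + t * r.2.2)

/-- Adding an update given as a multiple of `1 / B`. -/
noncomputable def jump (B : ℕ) (u : ℤ × ℤ × ℤ) (p : ℝ × ℝ × ℝ) : ℝ × ℝ × ℝ :=
  (p.1 + u.1 / B, p.2.1 + u.2.1 / B, p.2.2 + u.2.2 / B)

variable {B a b : ℕ} {x y : ℝ}

/-- In modes 0, 2, 4 and 6 the update adds `1` to the coordinate being emptied. Staying in `[0, 1]`
forces that coordinate to be `0`, which determines `t`. The odd modes have rate `0`, so waiting
there changes nothing, and their updates remove the added `1`. -/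
theorem cycle_unique (hB : 0 < B) {k : ℕ} (hk : k < 8) {t : ℝ}
    (h₁ : InCube (drift (cycleRate B k) t (cycleValue B a b x y k)))
    (h₂ : InCube (jump B (cycleUpdate B a b k)
      (drift (cycleRate B k) t (cycleValue B a b x y k)))) :
    jump B (cycleUpdate B a b k) (drift (cycleRate B k) t (cycleValue B a b x y k)) =
      cycleValue B a b x y (k + 1) := by
  have hB' : (B : ℝ) ≠ 0 := by positivity
  interval_cases k <;>
    simp [InCube, drift, jump, cycleRate, cycleUpdate, cycleValue, hB', neg_div] at h₁ h₂ ⊢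
  · constructor <;> linarith
  · obtain ⟨-, -, h₁, -⟩ := h₁
    obtain ⟨-, -, -, h₂⟩ := h₂
    rw [eq_div_iff hB']
    constructor <;> linarith
  · constructor <;> ring
  · constructor <;> linarith
  · obtain ⟨-, -, h₁, -⟩ := h₁
    obtain ⟨-, -, -, h₂⟩ := h₂
    have ht : t = y - b / B := by linarith
    subst ht
    refine ⟨by field_simp, by ring⟩

/-- Conversely, the forced waiting times are admissible as soon as the guess `b` satisfies `hb`. -/
theorem cycle_exists (hB : 0 < B) {k : ℕ} (hk : k < 8) (hx : 0 ≤ x ∧ x ≤ 1) (hy : 0 ≤ y ∧ y ≤ 1)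
    (hb : 0 ≤ B * y - b ∧ B * y - b ≤ 1) (ha : a + 1 ≤ B) :
    0 ≤ cycleTime B b x y k ∧ InCube (cycleValue B a b x y k) ∧
    InCube (drift (cycleRate B k) (cycleTime B b x y k) (cycleValue B a b x y k)) ∧
    jump B (cycleUpdate B a b k)
      (drift (cycleRate B k) (cycleTime B b x y k) (cycleValue B a b x y k)) =
      cycleValue B a b x y (k + 1) := by
  have hB' : (B : ℝ) ≠ 0 := by positivity
  have hB₁ : (1 : ℝ) ≤ B := by exact_mod_cast hB
  have ha' : (a : ℝ) + 1 ≤ B := by exact_mod_cast ha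
  have ha₀ : (0 : ℝ) ≤ a := Nat.cast_nonneg a
  have hb₀ : (0 : ℝ) ≤ b := Nat.cast_nonneg b
  have e₁ : 0 ≤ x / B ∧ x / B ≤ 1 :=
    ⟨div_nonneg (by linarith) (by linarith), (div_le_one (by linarith)).2 (by linarith)⟩
  have e₂ : 0 ≤ (a + x) / B ∧ (a + x) / B ≤ 1 :=
    ⟨div_nonneg (by linarith) (by linarith), (div_le_one (by linarith)).2 (by linarith)⟩
  have e₃ : 0 ≤ y - b / B ∧ y - b / B ≤ 1 := by
    have : 0 ≤ (b : ℝ) / B := by positivity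
    refine ⟨?_, by linarith⟩
    rw [sub_nonneg, div_le_iff₀ (by linarith)]; linarith
  have e₄ : (y - b / B) * B = B * y - b := by field_simp
  have e₅ : (a + x) / B = x / B + a / B := by ring
  interval_cases k <;>
    simp [InCube, drift, jump, cycleRate, cycleUpdate, cycleValue, cycleTime, hB', neg_div] <;>
    and_intros <;> linarith
end Cycle

/-! ### Boxes as invariants -/

/-- The polytope of valuations with `x, y ∈ [0, 1]` and `z ∈ [c, c + 1]`. -/
def boxAt (c : ℤ) : Polyhedral 3 :=
  (List.finRange 3).flatMap fun i =>
    [⟨Pi.single i 1, .ge, Pi.single (M := fun _ => ℤ) 2 c i⟩,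
      ⟨Pi.single i 1, .le, Pi.single (M := fun _ => ℤ) 2 c i + 1⟩]

theorem mem_sem_boxAt (c : ℤ) (v : Fin 3 → ℝ) :
    v ∈ (boxAt c).sem ↔ (0 ≤ v 0 ∧ v 0 ≤ 1) ∧ (0 ≤ v 1 ∧ v 1 ≤ 1) ∧ c ≤ v 2 ∧ v 2 ≤ c + 1 := by
  have h : ∀ i, ∑ j, ((Pi.single (M := fun _ => ℤ) i 1 j : ℤ) : ℝ) * v j = v i := fun i => by
    simp [Pi.single_apply]
  have h' : v ∈ (boxAt c).sem ↔ ∀ i : Fin 3,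
      ((Pi.single (M := fun _ => ℤ) 2 c i : ℤ) : ℝ) ≤ v i ∧
        v i ≤ ((Pi.single (M := fun _ => ℤ) 2 c i + 1 : ℤ) : ℝ) := by
    simp only [Polyhedral.sem, boxAt, Set.mem_ofPred_eq, List.mem_flatMap, List.mem_finRange,
      true_and, List.mem_cons, List.not_mem_nil, or_false]
    refine ⟨fun H i => ⟨?_, ?_⟩, ?_⟩
    · have := H _ ⟨i, Or.inl rfl⟩
      simpa only [LinConstraint.Sat, Cmp.Holds, h] using this
    · have := H _ ⟨i, Or.inr rfl⟩
      simpa only [LinConstraint.Sat, Cmp.Holds, h] using this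
    · rintro H _ ⟨i, rfl | rfl⟩
      · simpa only [LinConstraint.Sat, Cmp.Holds, h] using (H i).1
      · simpa only [LinConstraint.Sat, Cmp.Holds, h] using (H i).2
  rw [h', Fin.forall_fin_succ, Fin.forall_fin_succ, Fin.forall_fin_one]
  simp

theorem sem_boxAt_eq_Icc (c : ℤ) :
    (boxAt c).sem = Set.Icc (![0, 0, c] : Fin 3 → ℝ) ![1, 1, c + 1] := by
  ext v
  rw [mem_sem_boxAt, Set.mem_Icc, Pi.le_def, Pi.le_def]
  simp [Fin.forall_fin_succ]
  tauto

theorem isBounded_sem_boxAt (c : ℤ) : Bornology.IsBounded (boxAt c).sem := by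
  rw [sem_boxAt_eq_Icc]; exact Metric.isBounded_Icc _ _

theorem isClosed_sem_boxAt (c : ℤ) : IsClosed (boxAt c).sem := by
  rw [sem_boxAt_eq_Icc]; exact isClosed_Icc

/-- A flow between two points of a box stays in the box. -/
theorem ModeData.flowFor_mem_boxAt {c : ℤ} (μ : ModeData 3) {v : Fin 3 → ℝ} {t τ : ℝ}
    (hv : v ∈ (boxAt c).sem) (ht : μ.flowFor v t ∈ (boxAt c).sem) (hτ : τ ∈ Set.Icc 0 t) :
    μ.flowFor v τ ∈ (boxAt c).sem := by
  rw [sem_boxAt_eq_Icc] at *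
  have key : ∀ i, min (v i) (μ.flowFor v t i) ≤ μ.flowFor v τ i ∧
      μ.flowFor v τ i ≤ max (v i) (μ.flowFor v t i) := fun i => by
    simp only [ModeData.flowFor]
    obtain ⟨h₀, h₁⟩ := hτ
    rcases le_total 0 (μ.flow i).val with h | h
    · exact ⟨min_le_of_left_le (by nlinarith), le_max_of_le_right (by nlinarith)⟩
    · exact ⟨min_le_of_right_le (by nlinarith), le_max_of_le_left (by nlinarith)⟩
  exact ⟨fun i => (le_min (hv.1 i) (ht.1 i)).trans (key i).1,
    fun i => (key i).2.trans (max_le (hv.2 i) (ht.2 i))⟩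

/-! ### Modes, and tapes oriented by the direction of a move -/

/-- The modes of the automaton that simulates a Turing machine. -/
inductive SimMode (Γ Λ : Type)
  | scan (q : Λ) (a : Γ)
  | shift (d : Dir) (q : Λ) (a b : Γ) (k : Fin 8)
  | halt

namespace SimMode

variable {Γ Λ : Type}

instance [Finite Γ] [Finite Λ] : Finite (SimMode Γ Λ) := by
  have : Finite Dir := Finite.of_injective (fun d => decide (d = Dir.left)) fun a b h => by
    cases a <;> cases b <;> simp at h ⊢
  refine Finite.of_injective
    (β := (Λ × Γ) ⊕ (Dir × Λ × Γ × Γ × Fin 8) ⊕ Unit)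
    (fun m => match m with
      | scan q a => Sum.inl (q, a)
      | shift d q a b k => Sum.inr (Sum.inl (d, q, a, b, k))
      | halt => Sum.inr (Sum.inr ())) fun m m' h => ?_
  cases m <;> cases m' <;> simp at h ⊢ <;> exact h

/-- The lower bound for `z` in the invariant. -/
def level : SimMode Γ Λ → ℤ
  | halt => 2
  | _ => 0

theorem level_of_ne_halt {m : SimMode Γ Λ} (h : m ≠ halt) : m.level = 0 := by
  cases m <;> first | rfl | exact absurd rfl h

end SimMode

/-- Arrange three entries as a vector, with the first two in an order given by a direction. -/
def pack {α : Type} : Dir → α × α × α → Fin 3 → α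
  | .right, p => ![p.1, p.2.1, p.2.2]
  | .left, p => ![p.2.1, p.1, p.2.2]

theorem pack_mem_boxAt_zero {d : Dir} {p : ℝ × ℝ × ℝ} : pack d p ∈ (boxAt 0).sem ↔ InCube p := by
  rw [mem_sem_boxAt]
  cases d
  · simp [pack, InCube]
    tauto
  · simp [pack, InCube]

theorem pack_jump_drift (d : Dir) (B : ℕ) (u r : ℤ × ℤ × ℤ) (t : ℝ) (p : ℝ × ℝ × ℝ) :
    pack d (jump B u (drift r t p)) =
      fun i => pack d p i + t * (pack d r i : ℤ) + ((pack d u i : ℤ) : ℝ) / B := by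
  funext i
  cases d <;> fin_cases i <;> rfl

theorem pack_drift (d : Dir) (r : ℤ × ℤ × ℤ) (t : ℝ) (p : ℝ × ℝ × ℝ) :
    pack d (drift r t p) = fun i => pack d p i + t * (pack d r i : ℤ) := by
  funext i
  cases d <;> fin_cases i <;> rfl

/-- The tape with the head on `c`, with `A` on the side that the head moves away from when it
moves in direction `d`, and `C` on the other side. -/
def sideTape {Γ : Type} [Inhabited Γ] : Dir → ListBlank Γ → Γ → ListBlank Γ → Tape Γ
  | .right, A, c, C => ⟨c, A, C⟩
  | .left, A, c, C => ⟨c, C, A⟩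

theorem sideTape_move {Γ : Type} [Inhabited Γ] (d : Dir) (A : ListBlank Γ) (c : Γ)
    (C : ListBlank Γ) : (sideTape d A c C).move d = sideTape d (A.cons c) C.head C.tail := by
  cases d <;> rfl

theorem exists_eq_sideTape {Γ : Type} [Inhabited Γ] (d : Dir) (T : Tape Γ) :
    ∃ A C, T = sideTape d A T.head C := by
  cases d
  · exact ⟨T.right, T.left, rfl⟩
  · exact ⟨T.left, T.right, rfl⟩

theorem sideTape_head {Γ : Type} [Inhabited Γ] (d : Dir) (A : ListBlank Γ) (c : Γ)
    (C : ListBlank Γ) : (sideTape d A c C).head = c := by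
  cases d <;> rfl

/-- The list of the elements of a finite type. -/
noncomputable def elements (α : Type) [Finite α] : List α :=
  (Set.toFinite (Set.univ : Set α)).toFinset.toList

theorem mem_elements {α : Type} [Finite α] (a : α) : a ∈ elements α := by
  simp [elements]

/-! ### The simulation on modes and valuations -/

/-- A Turing machine with a numbering of its symbols by even digits. -/
structure NumberedMachine (Γ Λ : Type) [Inhabited Γ] [Inhabited Λ] where
  machine : TM0.Machine Γ Λ
  base : ℕ
  digit : Γ → ℕ
  digit_default : digit default = 0
  digit_lt : ∀ a, digit a + 1 ≤ base
  digit_even : ∀ a, Even (digit a)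
  digit_injective : Function.Injective digit

namespace NumberedMachine

open SimMode

variable {Γ Λ : Type} [Inhabited Γ] [Inhabited Λ] (N : NumberedMachine Γ Λ)

theorem base_pos : 0 < N.base := Nat.lt_of_lt_of_le (Nat.succ_pos _) (N.digit_lt default)

/-- The transitions of the simulation: updates, as multiples of `1 / base`, and target modes. -/
noncomputable def next [Finite Γ] : SimMode Γ Λ → List ((Fin 3 → ℤ) × SimMode Γ Λ)
  | scan q a => match N.machine q a with
    | none => [(pack .right (0, 0, 2 * N.base), halt)]
    | some (q', .write b) => [(fun _ => 0, scan q' b)]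
    | some (q', .move d) => (elements Γ).map fun b => (fun _ => 0, shift d q' a b 0)
  | shift d q a b k =>
    [(pack d (cycleUpdate N.base (N.digit a) (N.digit b) k),
      if h : (k : ℕ) + 1 < 8 then shift d q a b ⟨k + 1, h⟩ else scan q b)]
  | halt => []

/-- The rates of the modes. -/
def rate : SimMode Γ Λ → Fin 3 → ℤ
  | shift d _ _ _ k => pack d (cycleRate N.base k)
  | _ => fun _ => 0

/-- The steps of the simulation. -/
def SimStep [Finite Γ] (c c' : SimMode Γ Λ × (Fin 3 → ℝ)) : Prop :=
  ∃ (t : ℝ) (u : Fin 3 → ℤ), 0 ≤ t ∧ (u, c'.1) ∈ N.next c.1 ∧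
    c.2 ∈ (boxAt c.1.level).sem ∧
    (fun i => c.2 i + t * (N.rate c.1 i : ℝ)) ∈ (boxAt c.1.level).sem ∧
    c'.2 ∈ (boxAt c'.1.level).sem ∧
    c'.2 = fun i => c.2 i + t * (N.rate c.1 i : ℝ) + (u i : ℝ) / N.base

/-- The number that encodes a half-tape. -/
noncomputable def value (l : ListBlank Γ) : ℝ := tapeValue N.base N.digit N.digit_default l

/-- The valuation that encodes a tape. -/
noncomputable def tapeVec (T : Tape Γ) : Fin 3 → ℝ :=
  pack .right (N.value T.left, N.value T.right, 0)

theorem tapeVec_sideTape (d : Dir) (A : ListBlank Γ) (c : Γ) (C : ListBlank Γ) :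
    N.tapeVec (sideTape d A c C) = pack d (N.value A, N.value C, 0) := by
  cases d <;> rfl

theorem value_mem (l : ListBlank Γ) : 0 ≤ N.value l ∧ N.value l < 1 :=
  ⟨tapeValue_nonneg _ _ _ l, tapeValue_lt_one _ _ _ N.digit_lt l⟩

theorem value_cons (a : Γ) (l : ListBlank Γ) :
    N.value (l.cons a) = (N.digit a + N.value l) / N.base := tapeValue_cons _ _ _ a l

theorem base_mul_value (l : ListBlank Γ) :
    N.base * N.value l = N.digit l.head + N.value l.tail := by
  have : (N.base : ℝ) ≠ 0 := by have := N.base_pos; positivity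
  conv_lhs => rw [← ListBlank.cons_head_tail l, value_cons]
  field_simp

theorem tapeVec_mem (T : Tape Γ) : N.tapeVec T ∈ (boxAt 0).sem := by
  have h₁ := N.value_mem T.left
  have h₂ := N.value_mem T.right
  exact pack_mem_boxAt_zero.2 ⟨⟨h₁.1, h₁.2.le⟩, ⟨h₂.1, h₂.2.le⟩, le_rfl, zero_le_one⟩

theorem rest_mem (T : Tape Γ) (r : Fin 3 → ℝ) :
    (fun i => N.tapeVec T i + 0 * r i) ∈ (boxAt 0).sem := by
  simp only [zero_mul, add_zero]
  exact N.tapeVec_mem T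

/-- Only the first symbol of a half-tape can be removed from its encoding. -/
theorem eq_head_of_mem {l : ListBlank Γ} {b : Γ} (h₀ : 0 ≤ N.base * N.value l - N.digit b)
    (h₁ : N.base * N.value l - N.digit b ≤ 1) : b = l.head := by
  rw [base_mul_value] at h₀ h₁
  obtain ⟨h₂, h₃⟩ := N.value_mem l.tail
  refine N.digit_injective ?_
  obtain ⟨m, hm⟩ := N.digit_even b
  obtain ⟨n, hn⟩ := N.digit_even l.head
  have e₁ : (N.digit b : ℝ) < N.digit l.head + 1 := by linarith
  have e₂ : (N.digit l.head : ℝ) ≤ N.digit b + 1 := by linarith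
  have e₁' : N.digit b < N.digit l.head + 1 := by exact_mod_cast e₁
  have e₂' : N.digit l.head ≤ N.digit b + 1 := by exact_mod_cast e₂
  -- The two bounds leave only equality or `digit b = digit l.head - 1`. The latter could survive in
  -- the closed interval when the tail has value `0`; parity excludes it.
  omega

/-- What is known about the configurations reached by the simulation. -/
def Invariant (c₀ : TM0.Cfg Γ Λ) : SimMode Γ Λ × (Fin 3 → ℝ) → Prop
  | (scan q a, v) => ∃ T : Tape Γ, T.head = a ∧ TM0.Reaches N.machine c₀ ⟨q, T⟩ ∧ v = N.tapeVec T
  | (shift d q a b k, v) => ∃ A C : ListBlank Γ,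
      TM0.Reaches N.machine c₀ ⟨q, sideTape d (A.cons a) C.head C.tail⟩ ∧
      v = pack d (cycleValue N.base (N.digit a) (N.digit b) (N.value A) (N.value C) k)
  | (halt, _) => ∃ c, TM0.Reaches N.machine c₀ c ∧ TM0.step N.machine c = none

/-- During a cycle the invariant already refers to the machine configuration after the move, whereas
the guess `b` remains unchecked until the last mode is left. -/
theorem Invariant.step [Finite Γ] {c₀ : TM0.Cfg Γ Λ} {c c' : SimMode Γ Λ × (Fin 3 → ℝ)}
    (h : N.Invariant c₀ c) (hs : N.SimStep c c') : N.Invariant c₀ c' := by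
  obtain ⟨m, v⟩ := c
  obtain ⟨m', v'⟩ := c'
  obtain ⟨t, u, ht, hn, h₁, h₂, h₃, h₄⟩ := hs
  dsimp only at hn h₁ h₂ h₃ h₄
  cases m with
  | halt => simp [next] at hn
  | scan q a =>
    obtain ⟨T, rfl, hT, rfl⟩ := h
    have hv : ∀ i, N.tapeVec T i + t * (N.rate (scan q T.head : SimMode Γ Λ) i : ℝ) =
      N.tapeVec T i := fun i => by simp [rate]
    simp only [hv] at h₄
    simp only [next] at hn
    rcases hM : N.machine q T.head with _ | ⟨q', d | b⟩ <;> rw [hM] at hn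
    · simp only [List.mem_singleton, Prod.mk.injEq] at hn
      obtain ⟨-, rfl⟩ := hn
      exact ⟨_, hT, by simp [TM0.step, hM]⟩
    · simp only [List.mem_map, Prod.mk.injEq] at hn
      obtain ⟨b, -, rfl, rfl⟩ := hn
      obtain ⟨A, C, hAC⟩ := exists_eq_sideTape d T
      refine ⟨A, C, hT.tail ?_, ?_⟩
      · simp only [TM0.step, hM, Option.map_some, Option.mem_def, Option.some.injEq]
        rw [← sideTape_move, ← hAC]
      · rw [h₄, hAC, tapeVec_sideTape]
        funext i
        simp [cycleValue]
    · simp only [List.mem_singleton, Prod.mk.injEq] at hn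
      obtain ⟨rfl, rfl⟩ := hn
      refine ⟨T.write b, rfl, hT.tail ?_, ?_⟩
      · simp [TM0.step, hM]
      · rw [h₄]
        funext i
        simp only [Int.cast_zero, zero_div, add_zero]
        rfl
  | shift d q a b k =>
    obtain ⟨A, C, hT, rfl⟩ := h
    simp only [next, List.mem_singleton, Prod.mk.injEq] at hn
    obtain ⟨rfl, hm⟩ := hn
    have hl : m'.level = 0 := by rw [hm]; split_ifs <;> rfl
    rw [hl] at h₃
    simp only [rate, level, ← pack_drift] at h₂
    simp only [rate, ← pack_jump_drift] at h₄
    have h₂' := pack_mem_boxAt_zero.1 h₂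
    rw [h₄] at h₃
    have h₃' := pack_mem_boxAt_zero.1 h₃
    have e := cycle_unique N.base_pos k.isLt h₂' h₃'
    rw [e] at h₄ h₃'
    split_ifs at hm with hk
    · subst hm
      exact ⟨A, C, hT, h₄⟩
    · subst hm
      have hk : (k : ℕ) = 7 := by omega
      rw [hk] at h₄ h₃'
      obtain ⟨-, h₅, -⟩ := h₃'
      -- At the end of the cycle the second coordinate is `B y - b`, and its membership in `[0, 1]`
      -- certifies the guess.
      have hb := N.eq_head_of_mem h₅.1 h₅.2
      refine ⟨_, (sideTape_head _ _ _ _).trans hb.symm, hT, ?_⟩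
      rw [h₄, tapeVec_sideTape, value_cons, hb]
      simp only [cycleValue, base_mul_value, add_sub_cancel_left]

/-- A write takes one step without delay. A move takes one step that guesses the correct symbol
`C.head`, followed by the eight steps of the cycle. -/
theorem simStep_of_step [Finite Γ] {q q' : Λ} {T T' : Tape Γ}
    (h : TM0.step N.machine ⟨q, T⟩ = some ⟨q', T'⟩) :
    Relation.ReflTransGen N.SimStep (scan q T.head, N.tapeVec T)
      (scan q' T'.head, N.tapeVec T') := by
  rcases hM : N.machine q T.head with _ | ⟨q₁, d | b⟩
  · simp [TM0.step, hM] at h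
  · simp only [TM0.step, hM, Option.map_some, Option.some.injEq, TM0.Cfg.mk.injEq] at h
    obtain ⟨rfl, rfl⟩ := h
    obtain ⟨A, C, hAC⟩ := exists_eq_sideTape d T
    have hA := N.value_mem A
    have hC := N.value_mem C
    have hC' := N.value_mem C.tail
    generalize ha : T.head = a at hM hAC
    have hmove : T.move d = sideTape d (A.cons a) C.head C.tail := by rw [hAC, sideTape_move]
    have hb : 0 ≤ N.base * N.value C - N.digit C.head ∧
        N.base * N.value C - N.digit C.head ≤ 1 := by
      rw [base_mul_value, add_sub_cancel_left]
      exact ⟨hC'.1, hC'.2.le⟩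
    let val := cycleValue N.base (N.digit a) (N.digit C.head) (N.value A) (N.value C)
    have hcyc : ∀ k < 8, _ := fun k hk => cycle_exists (B := N.base) (a := N.digit a)
      (b := N.digit C.head) (x := N.value A) (y := N.value C) N.base_pos hk ⟨hA.1, hA.2.le⟩
      ⟨hC.1, hC.2.le⟩ hb (N.digit_lt a)
    have hend : N.tapeVec (T.move d) = pack d (val 8) := by
      rw [hmove, tapeVec_sideTape, value_cons]
      simp only [val, cycleValue, base_mul_value, add_sub_cancel_left]
    have hval : ∀ k ≤ 8, pack d (val k) ∈ (boxAt 0).sem := fun k hk => by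
      rcases hk.lt_or_eq with hk | rfl
      · exact pack_mem_boxAt_zero.2 (hcyc k hk).2.1
      · rw [← hend]; exact N.tapeVec_mem _
    have hfirst : N.SimStep (scan q a, N.tapeVec T) (shift d q₁ a C.head 0, pack d (val 0)) := by
      refine ⟨0, fun _ => 0, le_rfl, ?_, N.tapeVec_mem T, ?_, hval 0 (by omega), ?_⟩
      · simp only [next, hM]
        exact List.mem_map.2 ⟨_, mem_elements C.head, rfl⟩
      · exact N.rest_mem T _
      · rw [hAC, tapeVec_sideTape]
        funext i
        simp [val, cycleValue]
    have hstep : ∀ (k : ℕ) (hk : k < 8) (m : SimMode Γ Λ),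
        (pack d (cycleUpdate N.base (N.digit a) (N.digit C.head) k), m) ∈
          N.next (shift d q₁ a C.head ⟨k, hk⟩) →
        N.SimStep (shift d q₁ a C.head ⟨k, hk⟩, pack d (val k)) (m, pack d (val (k + 1))) := by
      intro k hk m hm
      obtain ⟨h₀, h₁, h₂, h₃⟩ := hcyc k hk
      refine ⟨_, _, h₀, hm, pack_mem_boxAt_zero.2 h₁, ?_, ?_, ?_⟩
      · rw [← pack_mem_boxAt_zero (d := d), pack_drift] at h₂
        exact h₂
      · have : m.level = 0 := by
          simp only [next, List.mem_singleton, Prod.mk.injEq, true_and] at hm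
          rw [hm]
          split_ifs <;> rfl
        dsimp only
        rw [this]
        exact hval (k + 1) (by omega)
      · have := pack_jump_drift d N.base (cycleUpdate N.base (N.digit a) (N.digit C.head) k)
          (cycleRate N.base k) (cycleTime N.base (N.digit C.head) (N.value A) (N.value C) k) (val k)
        rw [h₃] at this
        exact this
    have hcycle : ∀ (k : ℕ) (hk : k < 8), Relation.ReflTransGen N.SimStep
        (scan q a, N.tapeVec T) (shift d q₁ a C.head ⟨k, hk⟩, pack d (val k)) := by
      intro k
      induction k with
      | zero => exact fun _ => Relation.ReflTransGen.single hfirst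
      | succ k ih =>
        intro hk
        refine (ih (by omega)).tail (hstep k (by omega) _ ?_)
        simp [next, hk]
    rw [hmove, sideTape_head, ← hmove, hend]
    refine (hcycle 7 (by omega)).tail (hstep 7 (by omega) _ ?_)
    simp [next]
  · simp only [TM0.step, hM, Option.map_some, Option.some.injEq, TM0.Cfg.mk.injEq] at h
    obtain ⟨rfl, rfl⟩ := h
    refine Relation.ReflTransGen.single
      ⟨0, fun _ => 0, le_rfl, ?_, N.tapeVec_mem T, ?_, N.tapeVec_mem _, ?_⟩
    · simp only [next, hM, List.mem_singleton]
      rfl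
    · exact N.rest_mem T _
    · funext i
      simp only [zero_mul, Int.cast_zero, zero_div, add_zero]
      rfl

/-- The simulation reaches the halting mode if and only if the machine halts. -/
theorem reaches_halt_iff [Finite Γ] (q : Λ) (T : Tape Γ) :
    (∃ v, Relation.ReflTransGen N.SimStep (scan q T.head, N.tapeVec T) (halt, v)) ↔
      ∃ c, TM0.Reaches N.machine ⟨q, T⟩ c ∧ TM0.step N.machine c = none := by
  constructor
  · rintro ⟨v, h⟩
    have key : ∀ c, Relation.ReflTransGen N.SimStep (scan q T.head, N.tapeVec T) c →
        N.Invariant ⟨q, T⟩ c := fun c hc => by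
      induction hc with
      | refl => exact ⟨T, rfl, Relation.ReflTransGen.refl, rfl⟩
      | tail _ hs ih => exact ih.step N hs
    exact key _ h
  · rintro ⟨c, hc, hs⟩
    have key : ∀ c : TM0.Cfg Γ Λ, TM0.Reaches N.machine ⟨q, T⟩ c →
        Relation.ReflTransGen N.SimStep (scan q T.head, N.tapeVec T)
          (scan c.q c.Tape.head, N.tapeVec c.Tape) := fun c hc => by
      induction hc with
      | refl => exact Relation.ReflTransGen.refl
      | tail _ hs ih => exact ih.trans (N.simStep_of_step hs)
    have hM : N.machine c.q c.Tape.head = none := by simpa [TM0.step] using hs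
    have hB : (N.base : ℝ) ≠ 0 := by have := N.base_pos; positivity
    refine ⟨_, (key c hc).tail
      ⟨0, pack .right (0, 0, 2 * N.base), le_rfl, ?_, N.tapeVec_mem _, ?_, ?_, rfl⟩⟩
    · simp [next, hM]
    · exact N.rest_mem c.Tape _
    · have := (mem_sem_boxAt 0 _).1 (N.tapeVec_mem c.Tape)
      refine (mem_sem_boxAt 2 _).2 ?_
      simpa [pack, tapeVec, hB, rate] using this

end NumberedMachine

/-! ### The simulation as a weak automaton -/

namespace NumberedMachine

open SimMode

variable {Γ Λ : Type} [Inhabited Γ] [Inhabited Λ] [Finite Γ] [Finite Λ]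
  (N : NumberedMachine Γ Λ)

/-- The numbering of the modes. -/
noncomputable def index : SimMode Γ Λ ≃ Fin (Nat.card (SimMode Γ Λ)) := Finite.equivFin _

/-- The data of a mode. -/
def modeData (m : SimMode Γ Λ) : ModeData 3 := ⟨boxAt m.level, fun i => (N.rate m i, 1)⟩

/-- A transition without guard and resets. -/
noncomputable def transition (m : SimMode Γ Λ) (u : Fin 3 → ℤ) (m' : SimMode Γ Λ) :
    Transition 3 :=
  ⟨index m, [], fun _ => false, fun i => (u i, ⟨N.base, N.base_pos⟩), index m'⟩

/-- An update that leads out of the unit cube. -/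
def blocked : Fin 3 → ℤ := fun _ => 2 * N.base

open Classical in
/-- The updates and targets of the transitions from a mode.  The blocked transitions only serve to
make the modes strongly connected. -/
noncomputable def outgoing (m : SimMode Γ Λ) : List ((Fin 3 → ℤ) × SimMode Γ Λ) :=
  N.next m ++ if m = halt then [] else
    ((elements (SimMode Γ Λ)).filter (· ≠ halt)).map fun m' => (N.blocked, m')

theorem mem_outgoing {m m' : SimMode Γ Λ} {u : Fin 3 → ℤ} :
    (u, m') ∈ N.outgoing m ↔ (u, m') ∈ N.next m ∨ (m ≠ halt ∧ m' ≠ halt ∧ u = N.blocked) := by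
  by_cases h : m = halt
  · simp [outgoing, h]
  · simp only [outgoing, h, if_false, List.mem_append, List.mem_map, List.mem_filter,
      mem_elements, true_and, Prod.mk.injEq, decide_eq_true_eq, ne_eq, not_false_eq_true]
    refine or_congr_right ⟨?_, ?_⟩
    · rintro ⟨_, h₁, rfl, rfl⟩; exact ⟨h₁, rfl⟩
    · rintro ⟨h₁, rfl⟩; exact ⟨_, h₁, rfl, rfl⟩

/-- The automaton that simulates the machine from its initial state, with the head on `a`. -/
noncomputable def automaton (a : Γ) : SHA 3 where
  modes := List.ofFn fun i : Fin (Nat.card (SimMode Γ Λ)) => N.modeData (index.symm i)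
  initial := [(index (scan default a : SimMode Γ Λ) : ℕ)]
  trans := (elements (SimMode Γ Λ)).flatMap fun m =>
    (N.outgoing m).map fun p => N.transition m p.1 p.2

theorem modes_length (a : Γ) : (N.automaton a).modes.length = Nat.card (SimMode Γ Λ) := by
  simp [automaton]

theorem modes_index (a : Γ) (m : SimMode Γ Λ) :
    (N.automaton a).modes[((index m : Fin _) : ℕ)]? = some (N.modeData m) := by
  simp [automaton]

omit [Inhabited Γ] [Inhabited Λ] in
theorem exists_index_of_lt {n : ℕ} (h : n < Nat.card (SimMode Γ Λ)) :
    ∃ m : SimMode Γ Λ, n = index m :=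
  ⟨index.symm ⟨n, h⟩, by simp⟩

theorem exists_of_modes_getElem? {a : Γ} {n : ℕ} {μ : ModeData 3}
    (h : (N.automaton a).modes[n]? = some μ) :
    ∃ m : SimMode Γ Λ, n = index m ∧ μ = N.modeData m := by
  obtain ⟨hn, -⟩ := List.getElem?_eq_some_iff.1 h
  rw [modes_length] at hn
  obtain ⟨m, rfl⟩ := exists_index_of_lt hn
  rw [modes_index, Option.some.injEq] at h
  exact ⟨m, rfl, h.symm⟩

theorem mem_trans {a : Γ} {δ : Transition 3} : δ ∈ (N.automaton a).trans ↔
    ∃ m u m', (u, m') ∈ N.outgoing m ∧ δ = N.transition m u m' := by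
  simp only [automaton, List.mem_flatMap, mem_elements, true_and, List.mem_map, Prod.exists]
  exact ⟨fun ⟨m, u, m', h, e⟩ => ⟨m, u, m', h, e.symm⟩,
    fun ⟨m, u, m', h, e⟩ => ⟨m, u, m', h, e.symm⟩⟩

omit [Inhabited Γ] [Inhabited Λ] in
theorem index_eq {m m' : SimMode Γ Λ} (h : ((index m : Fin _) : ℕ) = index m') : m = m' :=
  index.injective (Fin.ext h)

theorem transition_apply_flowFor (m m' : SimMode Γ Λ) (u : Fin 3 → ℤ) (v : Fin 3 → ℝ) (t : ℝ) :
    (N.transition m u m').apply ((N.modeData m).flowFor v t) =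
      fun i => v i + t * (N.rate m i : ℝ) + (u i : ℝ) / N.base := by
  funext i
  simp [Transition.apply, transition, ModeData.flowFor, modeData, Fraction.val]

omit [Finite Γ] [Finite Λ] in
theorem flowFor_eq (m : SimMode Γ Λ) (v : Fin 3 → ℝ) (t : ℝ) :
    (N.modeData m).flowFor v t = fun i => v i + t * (N.rate m i : ℝ) := by
  funext i
  simp [ModeData.flowFor, modeData, Fraction.val]

/-- The blocked transitions are the only ones that the simulation lacks. They are never taken:
before the update `x ≥ 0`, hence `x ≥ 2` after it, outside the cube. -/
theorem simStep_of_automaton_step {a : Γ} {m : SimMode Γ Λ} {v : Fin 3 → ℝ} {t : ℝ} {i : ℕ}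
    {c : Config 3} (h : (N.automaton a).Step (index m, v) t i c) :
    ∃ m' : SimMode Γ Λ, c.1 = index m' ∧ N.SimStep (m, v) (m', c.2) := by
  obtain ⟨ht, hc, hc', μ, δ, hμ, hδ, hs, he, hinv, -, happ⟩ := h
  dsimp only at hμ hs hinv happ
  rw [modes_index, Option.some.injEq] at hμ
  subst hμ
  obtain ⟨m₁, u, m', hu, rfl⟩ := N.mem_trans.1 (List.mem_of_getElem? hδ)
  obtain rfl : m₁ = m := index_eq hs
  obtain ⟨μ', hμ', hv'⟩ := hc'
  rw [← he] at hμ'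
  rw [show (N.transition m₁ u m').tgt = index m' from rfl, modes_index, Option.some.injEq] at hμ'
  subst hμ'
  refine ⟨m', he.symm, t, u, ht, ?_, ?_, ?_, hv', ?_⟩
  · rcases N.mem_outgoing.1 hu with hu | ⟨h₁, h₂, rfl⟩
    · exact hu
    · exfalso
      have h₃ := hinv t ⟨ht, le_rfl⟩
      rw [flowFor_eq] at h₃
      rw [happ, transition_apply_flowFor] at hv'
      simp only [modeData, level_of_ne_halt h₁, level_of_ne_halt h₂] at h₃ hv'
      have h₄ := ((mem_sem_boxAt _ _).1 h₃).1.1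
      have h₅ := ((mem_sem_boxAt _ _).1 hv').1.2
      have hB : (N.base : ℝ) ≠ 0 := by have := N.base_pos; positivity
      have e : ((N.blocked 0 : ℤ) : ℝ) / N.base = 2 := by
        simp only [blocked]; push_cast; field_simp
      rw [e] at h₅
      linarith
  · have := hinv 0 ⟨le_rfl, ht⟩
    rw [flowFor_eq] at this
    simpa [modeData] using this
  · have := hinv t ⟨ht, le_rfl⟩
    rwa [flowFor_eq] at this
  · rw [happ, transition_apply_flowFor]

/-- `SimStep` constrains only the endpoints of the flow; the box is convex, so the points between
them satisfy the invariant as well. -/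
theorem exists_automaton_step (a : Γ) {m m' : SimMode Γ Λ} {v v' : Fin 3 → ℝ}
    (h : N.SimStep (m, v) (m', v')) :
    ∃ t i, (N.automaton a).Step (index m, v) t i (index m', v') := by
  obtain ⟨t, u, ht, hu, h₁, h₂, h₃, h₄⟩ := h
  have hmem : N.transition m u m' ∈ (N.automaton a).trans :=
    N.mem_trans.2 ⟨m, u, m', N.mem_outgoing.2 (Or.inl hu), rfl⟩
  obtain ⟨i, hi⟩ := List.mem_iff_getElem?.1 hmem
  refine ⟨t, i, ht, ⟨_, N.modes_index a m, h₁⟩, ⟨_, N.modes_index a m', h₃⟩, _, _,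
    N.modes_index a m, hi, rfl, rfl, fun τ hτ => ?_, ?_, ?_⟩
  · refine (N.modeData m).flowFor_mem_boxAt h₁ ?_ hτ
    rw [flowFor_eq]
    exact h₂
  · intro c hc
    exact absurd hc List.not_mem_nil
  · rw [transition_apply_flowFor]
    exact h₄

/-- The halting mode has rank `1` and no outgoing transition; all other modes have rank `0`, share
the unit cube and are joined pairwise by blocked transitions. -/
theorem isWeak_automaton (a : Γ) : (N.automaton a).IsWeak := by
  classical
  refine ⟨⟨?_, ?_⟩, fun n => if n = index (halt : SimMode Γ Λ) then 1 else 0, ?_,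
    fun i => ⟨?_, ?_, ?_⟩⟩
  · intro n hn
    rw [modes_length]
    rw [List.mem_singleton.1 hn]
    exact Fin.isLt _
  · intro δ hδ
    obtain ⟨m, u, m', -, rfl⟩ := N.mem_trans.1 hδ
    rw [modes_length]
    exact ⟨Fin.isLt _, Fin.isLt _⟩
  · intro δ hδ
    obtain ⟨m, u, m', hu, rfl⟩ := N.mem_trans.1 hδ
    have hm : m ≠ halt := by
      rintro rfl
      rcases N.mem_outgoing.1 hu with hu | hu
      · simp [next] at hu
      · exact hu.1 rfl
    have : ((index m : Fin _) : ℕ) ≠ index (halt : SimMode Γ Λ) := fun h => hm (index_eq h)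
    exact (if_neg this).le.trans (Nat.zero_le _)
  · refine ⟨boxAt (if i = 0 then 0 else 2), isBounded_sem_boxAt _, fun n μ hn hi => ?_⟩
    obtain ⟨m, rfl, rfl⟩ := N.exists_of_modes_getElem? hn
    dsimp only at hi
    by_cases hm : m = halt
    · subst hm
      rw [if_pos rfl] at hi
      subst hi
      rfl
    · have : ((index m : Fin _) : ℕ) ≠ index (halt : SimMode Γ Λ) := fun h => hm (index_eq h)
      rw [if_neg this] at hi
      subst hi
      simp [modeData, level_of_ne_halt hm]
  · intro n hn n' hn' hi hi'
    rw [modes_length] at hn hn'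
    obtain ⟨m, rfl⟩ := exists_index_of_lt hn
    obtain ⟨m', rfl⟩ := exists_index_of_lt hn'
    dsimp only at hi hi'
    split_ifs at hi hi' with h₁ h₂ h₂
    · rw [h₁, h₂]
    · omega
    · omega
    · refine Relation.ReflTransGen.single ⟨N.transition m N.blocked m', N.mem_trans.2
        ⟨_, _, _, N.mem_outgoing.2 (Or.inr ⟨?_, ?_, rfl⟩), rfl⟩, rfl, rfl⟩
      · rintro rfl; exact h₁ rfl
      · rintro rfl; exact h₂ rfl
  · intro δ hδ _ _
    obtain ⟨m, u, m', -, rfl⟩ := N.mem_trans.1 hδ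
    exact ⟨Set.eq_univ_of_forall fun v c hc => absurd hc List.not_mem_nil, fun _ => rfl⟩

theorem hasClosedInvariants_automaton (a : Γ) : (N.automaton a).HasClosedInvariants := by
  intro μ hμ
  obtain ⟨n, hn⟩ := List.mem_iff_getElem?.1 hμ
  obtain ⟨m, -, rfl⟩ := N.exists_of_modes_getElem? hn
  exact isClosed_sem_boxAt _

theorem run_iff (a : Γ) {v₀ : Fin 3 → ℝ} (h₀ : v₀ ∈ (boxAt 0).sem) (c : Config 3) :
    (∃ r, (N.automaton a).Run (index (scan default a : SimMode Γ Λ), v₀) r c) ↔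
      ∃ m : SimMode Γ Λ, c.1 = index m ∧
        Relation.ReflTransGen N.SimStep (scan default a, v₀) (m, c.2) := by
  constructor
  · rintro ⟨r, hr⟩
    induction hr with
    | start => exact ⟨_, rfl, Relation.ReflTransGen.refl⟩
    | @step r c₁ c₂ t i _ hs ih =>
      obtain ⟨m, hm, hm'⟩ := ih
      obtain ⟨n, v⟩ := c₁
      dsimp only at hm hm'
      subst hm
      obtain ⟨m', h₁, h₂⟩ := N.simStep_of_automaton_step hs
      exact ⟨m', h₁, hm'.tail h₂⟩
  · rintro ⟨m, hm, h⟩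
    obtain ⟨n, v⟩ := c
    dsimp only at hm h
    subst hm
    have key : ∀ p : SimMode Γ Λ × (Fin 3 → ℝ),
        Relation.ReflTransGen N.SimStep (scan default a, v₀) p →
        ∃ r, (N.automaton a).Run (index (scan default a : SimMode Γ Λ), v₀) r (index p.1, p.2) := by
      intro p hp
      induction hp with
      | refl =>
        exact ⟨[], .start (List.mem_singleton.2 rfl) ⟨_, N.modes_index a _, h₀⟩⟩
      | @tail p p' _ hs ih =>
        obtain ⟨r, hr⟩ := ih
        obtain ⟨t, i, hti⟩ := N.exists_automaton_step a hs
        exact ⟨_, hr.step hti⟩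
    exact key _ h

/-- The target is reached if and only if the simulation reaches the halting mode. -/
theorem reachable_iff (a : Γ) {s : Fin 3 → Fraction}
    (hs : (fun i => (s i).val) ∈ (boxAt 0).sem) :
    (ReachInstance.mk (N.automaton a) s (boxAt 2)).Reachable ↔
      ∃ v, Relation.ReflTransGen N.SimStep (scan default a, fun i => (s i).val) (halt, v) := by
  constructor
  · rintro ⟨n, n', v, r, hr, hv⟩
    have hn : n = index (scan default a : SimMode Γ Λ) := by
      have : ∀ {c r c'}, (N.automaton a).Run c r c' → c.1 ∈ (N.automaton a).initial := by
        intro c r c' h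
        induction h with
        | start h _ => exact h
        | step _ _ ih => exact ih
      exact List.mem_singleton.1 (this hr)
    subst hn
    obtain ⟨m, hm, h⟩ := (N.run_iff a hs _).1 ⟨r, hr⟩
    dsimp only at hm h
    by_cases hh : m = halt
    · subst hh
      exact ⟨v, h⟩
    · exfalso
      -- Outside the halting mode `z ≤ 1`, whereas the target requires `z ≥ 2`.
      have : v ∈ (boxAt m.level).sem := by
        rcases Relation.ReflTransGen.cases_tail h with h | ⟨c, -, t, u, -, -, -, -, h, -⟩
        · obtain ⟨rfl, rfl⟩ := Prod.mk.inj h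
          exact hs
        · exact h
      rw [level_of_ne_halt hh] at this
      have h₁ := ((mem_sem_boxAt _ _).1 this).2.2.2
      have h₂ := ((mem_sem_boxAt _ _).1 hv).2.2.1
      norm_num at h₁ h₂
      linarith
  · rintro ⟨v, hv⟩
    obtain ⟨r, hr⟩ := (N.run_iff a hs (index (halt : SimMode Γ Λ), v)).2 ⟨halt, rfl, hv⟩
    refine ⟨_, _, v, r, hr, ?_⟩
    rcases Relation.ReflTransGen.cases_tail hv with h | ⟨c, -, t, u, -, -, -, -, h, -⟩
    · simp at h
    · exact h

/-! ### The instances and their computability -/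

/-- The numerator of the number with the digits `b, c, …, c`. -/
def numerator (b c : Γ) (k : ℕ) : ℕ :=
  Nat.rec (N.digit b) (fun _ n => N.base * n + N.digit c) k

omit [Finite Γ] [Finite Λ] in
theorem value_replicate (b c : Γ) (k : ℕ) :
    N.value (ListBlank.mk (b :: List.replicate k c)) =
      N.numerator b c k / (N.base ^ (k + 1) : ℕ) := by
  have hB : (N.base : ℝ) ≠ 0 := by have := N.base_pos; positivity
  rw [value, tapeValue_mk]
  induction k with
  | zero => simp [listValue, numerator]
  | succ k ih =>
    rw [List.replicate_succ', ← List.cons_append, listValue_append_singleton _ _ N.base_pos, ih]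
    have : N.numerator b c (k + 1) = N.base * N.numerator b c k + N.digit c := rfl
    rw [this]
    simp only [List.length_cons, List.length_replicate]
    push_cast
    field_simp
    ring

/-- The instance that asks whether the machine halts on the input `a, b, c, …, c`. -/
noncomputable def haltingInstance (a b c : Γ) (k : ℕ) : ReachInstance 3 :=
  ⟨N.automaton a, ![(0, 1), ((N.numerator b c k : ℕ), Nat.toPNat' (N.base ^ (k + 1))), (0, 1)],
    boxAt 2⟩

theorem reachable_haltingInstance_iff (a b c : Γ) (k : ℕ) :
    (N.haltingInstance a b c k).Reachable ↔
      (TM0.eval N.machine (a :: b :: List.replicate k c)).Dom := by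
  have hv : (fun i => ((N.haltingInstance a b c k).start i).val) =
      N.tapeVec (Tape.mk₁ (a :: b :: List.replicate k c)) := by
    have hp : 0 < N.base ^ (k + 1) := pow_pos N.base_pos _
    have h : N.tapeVec (Tape.mk₁ (a :: b :: List.replicate k c)) =
        pack .right (0, N.value (ListBlank.mk (b :: List.replicate k c)), 0) := rfl
    rw [h, value_replicate]
    funext i
    fin_cases i
    · simp [haltingInstance, Fraction.val, pack]
    · simp [haltingInstance, Fraction.val, pack, Nat.toPNat'_coe, hp]
    · simp [haltingInstance, Fraction.val, pack]
  have hs := N.tapeVec_mem (Tape.mk₁ (a :: b :: List.replicate k c))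
  rw [← hv] at hs
  refine (N.reachable_iff a hs).trans ?_
  rw [hv]
  refine (N.reaches_halt_iff default (Tape.mk₁ (a :: b :: List.replicate k c))).trans ?_
  change _ ↔ (StateTransition.eval (TM0.step N.machine) (TM0.init _)).Dom
  rw [Part.dom_iff_mem]
  simp only [StateTransition.mem_eval]
  rfl

omit [Finite Γ] [Finite Λ] in
theorem primrec_numerator (b c : Γ) : Primrec (N.numerator b c) :=
  Primrec.nat_rec₁ _ (Primrec.nat_add.comp (Primrec.nat_mul.comp (Primrec.const N.base) Primrec.snd)
    (Primrec.const (N.digit c))).to₂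

/-- Automaton and target are constants here, so it is enough to compute one fraction from `k`. -/
theorem computable_haltingInstance (a b c : Γ) : Computable (N.haltingInstance a b c) := by
  have hpow : Primrec fun k : ℕ => N.base ^ (k + 1) := by
    refine (Primrec.nat_rec₁ N.base (Primrec.nat_mul.comp (Primrec.const N.base)
      Primrec.snd).to₂).of_eq fun k => ?_
    induction k with
    | zero => simp
    | succ k ih => rw [pow_succ']; exact congrArg (N.base * ·) ih
  have hint : Primrec fun n : ℕ => (n : ℤ) := by
    -- The code of a nonnegative integer `n` is `2 * n`; that of a positive natural number, below,
    -- is its predecessor.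
    refine Primrec.encode_iff.1 (Primrec.nat_double.of_eq fun n => ?_)
    rfl
  have hpnat : Primrec Nat.toPNat' := by
    refine Primrec.encode_iff.1 (Primrec.pred.of_eq fun n => ?_)
    rfl
  have hfrac : Primrec fun k : ℕ =>
      (((N.numerator b c k : ℕ) : ℤ), Nat.toPNat' (N.base ^ (k + 1))) :=
    (hint.comp (N.primrec_numerator b c)).pair (hpnat.comp hpow)
  have hstart : Primrec fun k : ℕ =>
      (![(0, 1), (((N.numerator b c k : ℕ) : ℤ), Nat.toPNat' (N.base ^ (k + 1))), (0, 1)] :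
        Fin 3 → Fraction) := by
    refine Primrec.fin_curry.2 (Primrec₂.swap (Primrec.fin_curry₁.2 fun i => ?_))
    fin_cases i
    · exact Primrec.const _
    · exact hfrac
    · exact Primrec.const _
  have : Primrec (N.haltingInstance a b c) :=
    (Primrec.of_equiv_symm (e := ReachInstance.equivProd 3)).comp
      ((Primrec.const (N.automaton a)).pair (hstart.pair (Primrec.const (boxAt 2))))
  exact this.to_comp

end NumberedMachine

/-! ### The reduction from the halting problem -/

/-- No algorithm decides reachability for weak singular hybrid automata with three variables and
additive discrete updates, even if only its answers on automata with closed invariants count. -/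
theorem theorem7 :
    ¬ ∃ D : ReachInstance 3 → Prop, ComputablePred D ∧
      ∀ P : ReachInstance 3, P.aut.IsWeak → P.aut.HasClosedInvariants →
        Bornology.IsBounded P.target.sem → (D P ↔ P.Reachable) := by
  rintro ⟨D, hD, hspec⟩
  have huniv : Partrec fun n : ℕ => (Denumerable.ofNat Nat.Partrec.Code n).eval 0 :=
    Nat.Partrec.Code.eval_part.comp (Computable.ofNat _) (Computable.const 0)
  obtain ⟨Γ, Λ, _, _, _, _, M, a, b, c, hM⟩ := TM0.exists_machine_of_partrec huniv
  obtain ⟨B, digit, h₀, h₁, h₂, h₃⟩ := exists_even_digits Γ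
  let N : NumberedMachine Γ Λ := ⟨M, B, digit, h₀, h₁, h₂, h₃⟩
  refine ComputablePred.halting_problem 0 (ComputablePred.computable_of_manyOneReducible
    ⟨fun p => N.haltingInstance a b c (Encodable.encode p),
      (N.computable_haltingInstance a b c).comp Computable.encode, fun p => ?_⟩ hD)
  have h := hspec (N.haltingInstance a b c (Encodable.encode p)) (N.isWeak_automaton a)
    (N.hasClosedInvariants_automaton a) (isBounded_sem_boxAt 2)
  rw [h, N.reachable_haltingInstance_iff, hM, Denumerable.ofNat_encode]
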